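/- Let $\mathbb{D}$ be the open unit disc in $\mathbb{C}$. Let $H^2(\mathbb{D})$ be the Hardy space of holomorphic functions $f$ on $\mathbb{D}$ with \[ \|f\| := \Big[\sup_{0\le r<1}\frac{1}{2\pi}\int_0^{2\pi}|f(re^{it})|^2\,dt\Big]^{1/2}<\infty , \] let $H^\infty(\mathbb{D})$ be the algebra of bounded holomorphic functions on $\mathbb{D}$, and let $\mathcal{S}(\mathbb{D})=\{\psi\in H^\infty(\mathbb{D}) : \sup_{z\in\mathbb{D}}|\psi(z)|\le 1\}$ be the Schur class. Let $\theta$ be an inner function, that is, $\theta\in H^\infty(\mathbb{D})$ and the nontangential boundary values of $\theta$ exist and have modulus $1$ almost everywhere on $\partial\mathbb{D}$. Let $\varphi:\mathbb{D}\to\mathbb{D}$ be holomorphic, and put $C_\varphi f=f\circ\varphi$ for $f\in H^2(\mathbb{D})$. Then the following are equivalent: 1. $\theta H^2(\mathbb{D})\in\operatorname{Lat}C_\varphi$, that is, $\theta H^2(\mathbb{D})$ is a closed subspace of $H^2(\mathbb{D})$ and $C_\varphi(\theta H^2(\mathbb{D}))\subseteq\theta H^2(\mathbb{D})$; 2. $\dfrac{\theta\circ\varphi}{\theta}\in\mathcal{S}(\mathbb{D})$;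 3. $\dfrac{\theta\circ\varphi}{\theta}\in H^\infty(\mathbb{D})$; 4. $\dfrac{\theta\circ\varphi}{\theta}\in H^2(\mathbb{D})$. Here the quotient $\frac{\theta\circ\varphi}{\theta}$, defined off the zeros of $\theta$, is said to belong to a class of holomorphic functions on $\mathbb{D}$ if it extends across these zeros to a function in that class. -/

import Mathlib

open Complex MeasureTheory Filter Topology
open scoped ENNReal Complex.UnitDisc

noncomputable section

namespace HardyDisc

/-- Extension by `0` of a function on the open unit disc to the whole plane. -/
def extendZero (f : 𝔻 → ℂ) (z : ℂ) : ℂ :=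
  if h : ‖z‖ < 1 then f (UnitDisc.mk z h) else 0

theorem extendZero_add (f g : 𝔻 → ℂ) : extendZero (f + g) = extendZero f + extendZero g := by
  funext z
  by_cases h : ‖z‖ < 1 <;> simp [extendZero, h]

theorem extendZero_smul (c : ℂ) (f : 𝔻 → ℂ) : extendZero (c • f) = c • extendZero f := by
  funext z
  by_cases h : ‖z‖ < 1 <;> simp [extendZero, h]

theorem extendZero_zero : extendZero 0 = 0 := by
  funext z
  by_cases h : ‖z‖ < 1 <;> simp [extendZero, h]

theorem extendZero_coe (f : 𝔻 → ℂ) (z : 𝔻) : extendZero f z = f z := by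
  simp [extendZero, z.norm_lt_one]

/-- `f` is holomorphic on the open unit disc. -/
def IsHolomorphic (f : 𝔻 → ℂ) : Prop :=
  DifferentiableOn ℂ (extendZero f) (Metric.ball 0 1)

/-- Normalized arc length `dt / 2π` on one period. -/
def arcMeasure : Measure ℝ :=
  ENNReal.ofReal (1 / (2 * Real.pi)) • volume.restrict (Set.Ioc 0 (2 * Real.pi))

/-- The integral mean `((1 / 2π) ∫₀^{2π} |f(r e^{it})|² dt)^{1/2}`. -/
def circleMean (f : 𝔻 → ℂ) (r : ℝ) : ℝ≥0∞ :=
  eLpNorm (fun t : ℝ => extendZero f (circleMap 0 r t)) 2 arcMeasure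

/-- The `H²` norm, with value `∞` allowed: the supremum of the means over `0 ≤ r < 1`. -/
def hardyENorm (f : 𝔻 → ℂ) : ℝ≥0∞ := ⨆ r ∈ Set.Ico (0 : ℝ) 1, circleMean f r

theorem IsHolomorphic.continuous_circle {f : 𝔻 → ℂ} (hf : IsHolomorphic f) {r : ℝ}
    (hr : r ∈ Set.Ico (0 : ℝ) 1) :
    Continuous (fun t : ℝ => extendZero f (circleMap 0 r t)) := by
  refine hf.continuousOn.comp_continuous (continuous_circleMap 0 r) fun t => ?_
  simp [abs_of_nonneg hr.1, hr.2]

theorem circleMean_add_le {f g : 𝔻 → ℂ} (hf : IsHolomorphic f) (hg : IsHolomorphic g) {r : ℝ}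
    (hr : r ∈ Set.Ico (0 : ℝ) 1) :
    circleMean (f + g) r ≤ circleMean f r + circleMean g r := by
  unfold circleMean
  rw [extendZero_add]
  exact eLpNorm_add_le (hf.continuous_circle hr).aestronglyMeasurable
    (hg.continuous_circle hr).aestronglyMeasurable (by norm_num)

theorem hardyENorm_add_le {f g : 𝔻 → ℂ} (hf : IsHolomorphic f) (hg : IsHolomorphic g) :
    hardyENorm (f + g) ≤ hardyENorm f + hardyENorm g := by
  refine iSup₂_le fun r hr => (circleMean_add_le hf hg hr).trans ?_
  exact add_le_add (le_iSup₂ (f := fun r _ => circleMean f r) r hr)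
    (le_iSup₂ (f := fun r _ => circleMean g r) r hr)

theorem hardyENorm_smul (c : ℂ) (f : 𝔻 → ℂ) : hardyENorm (c • f) = ‖c‖ₑ * hardyENorm f := by
  have h : ∀ r, circleMean (c • f) r = ‖c‖ₑ * circleMean f r := fun r => by
    unfold circleMean
    rw [extendZero_smul]
    exact eLpNorm_const_smul c (fun t : ℝ => extendZero f (circleMap 0 r t)) 2 arcMeasure
  simp only [hardyENorm, h, ENNReal.mul_iSup]

theorem hardyENorm_zero : hardyENorm 0 = 0 := by
  simpa using hardyENorm_smul 0 0

/-- The Hardy space `H²` as a vector space of functions on the disc: the holomorphic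
functions whose `L²` means over the circles `|z| = r < 1` are bounded. -/
def hardySpace : Submodule ℂ (𝔻 → ℂ) where
  carrier := {f | IsHolomorphic f ∧ hardyENorm f < ∞}
  zero_mem' := by
    refine ⟨?_, by simp [hardyENorm_zero]⟩
    unfold IsHolomorphic
    rw [extendZero_zero]
    exact differentiableOn_const 0
  add_mem' := by
    rintro f g ⟨hf, hf'⟩ ⟨hg, hg'⟩
    refine ⟨?_, (hardyENorm_add_le hf hg).trans_lt (ENNReal.add_lt_top.2 ⟨hf', hg'⟩)⟩
    unfold IsHolomorphic
    rw [extendZero_add]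
    exact DifferentiableOn.add hf hg
  smul_mem' := by
    rintro c f ⟨hf, hf'⟩
    refine ⟨?_, by rw [hardyENorm_smul]; exact ENNReal.mul_lt_top enorm_lt_top hf'⟩
    unfold IsHolomorphic
    rw [extendZero_smul]
    exact DifferentiableOn.const_smul hf c

theorem eq_zero_of_hardyENorm_eq_zero {f : 𝔻 → ℂ} (hf : IsHolomorphic f)
    (h : hardyENorm f = 0) : f = 0 := by
  funext z
  have hr : ‖(z : ℂ)‖ ∈ Set.Ico (0 : ℝ) 1 := ⟨norm_nonneg _, z.norm_lt_one⟩
  have hm : circleMean f ‖(z : ℂ)‖ = 0 := by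
    have := le_iSup₂ (f := fun r (_ : r ∈ Set.Ico (0 : ℝ) 1) => circleMean f r) _ hr
    exact le_antisymm (this.trans h.le) bot_le
  have hcont := hf.continuous_circle hr
  have hae := (eLpNorm_eq_zero_iff hcont.aestronglyMeasurable (by norm_num)).1 hm
  have hae2 : (fun t : ℝ => extendZero f (circleMap 0 ‖(z : ℂ)‖ t))
      =ᵐ[volume.restrict (Set.Ioc 0 (2 * Real.pi))] fun _ => 0 := by
    have hc : ENNReal.ofReal (1 / (2 * Real.pi)) ≠ 0 := by
      simp [Real.pi_pos]
    exact (Measure.ae_ennreal_smul_measure_iff hc).1 hae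
  have hon := Measure.eqOn_Ioc_of_ae_eq volume hae2 hcont.continuousOn
    continuousOn_const
  obtain ⟨t, ht, hzt⟩ : ∃ t ∈ Set.Ioc (0 : ℝ) (2 * Real.pi), circleMap 0 ‖(z : ℂ)‖ t = z := by
    have hper := periodic_circleMap 0 ‖(z : ℂ)‖
    obtain ⟨t, ht, hte⟩ := hper.exists_mem_Ioc (by positivity) (Complex.arg (z : ℂ)) 0
    refine ⟨t, by simpa using ht, ?_⟩
    rw [← hte]
    simp [circleMap, Complex.norm_mul_exp_arg_mul_I]
  have := hon ht
  simp only [hzt, extendZero_coe] at this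
  simpa using this

/-- The Hardy space `H²` as a normed space. It is a separate type so that its topology is the
norm topology and not that of pointwise convergence. -/
def H2 : Type := hardySpace

instance : AddCommGroup H2 := inferInstanceAs (AddCommGroup hardySpace)

instance : Module ℂ H2 := inferInstanceAs (Module ℂ hardySpace)

instance : CoeFun H2 (fun _ => 𝔻 → ℂ) := ⟨fun f => f.1⟩

instance : Norm H2 := ⟨fun f => (hardyENorm (f : 𝔻 → ℂ)).toReal⟩

theorem H2.core : NormedSpace.Core ℂ H2 where
  norm_nonneg _ := ENNReal.toReal_nonneg
  norm_smul c f := by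
    change (hardyENorm (c • f.1)).toReal = ‖c‖ * (hardyENorm f.1).toReal
    rw [hardyENorm_smul, ENNReal.toReal_mul, toReal_enorm]
  norm_triangle f g := by
    change (hardyENorm (f.1 + g.1)).toReal ≤ (hardyENorm f.1).toReal + (hardyENorm g.1).toReal
    rw [← ENNReal.toReal_add f.2.2.ne g.2.2.ne]
    exact ENNReal.toReal_mono (ENNReal.add_lt_top.2 ⟨f.2.2, g.2.2⟩).ne
      (hardyENorm_add_le f.2.1 g.2.1)
  norm_eq_zero_iff f := by
    change (hardyENorm f.1).toReal = 0 ↔ f = 0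
    refine ⟨fun h => Subtype.ext ?_, ?_⟩
    · refine eq_zero_of_hardyENorm_eq_zero f.2.1 ?_
      exact ((ENNReal.toReal_eq_zero_iff _).1 h).resolve_right f.2.2.ne
    · rintro rfl
      change (hardyENorm 0).toReal = 0
      simp [hardyENorm_zero]

instance : NormedAddCommGroup H2 := NormedAddCommGroup.ofCore H2.core

instance : NormedSpace ℂ H2 := NormedSpace.ofCore H2.core

/-- `H^∞`: the bounded holomorphic functions on the disc. -/
def HInfty : Set (𝔻 → ℂ) := {f | IsHolomorphic f ∧ ∃ C : ℝ, ∀ z, ‖f z‖ ≤ C}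

/-- The Schur class: the closed unit ball of `H^∞` for the supremum norm. -/
def schurClass : Set (𝔻 → ℂ) := {f | f ∈ HInfty ∧ ∀ z, ‖f z‖ ≤ 1}

/-- `f` has nontangential limit `L` at the point `ζ` of the unit circle: `f(z) → L` as `z → ζ`
within each of the regions `|z - ζ| < M (1 - |z|)`, `M > 1`. -/
def HasNontangentialLimit (f : 𝔻 → ℂ) (ζ L : ℂ) : Prop :=
  ∀ M : ℝ, 1 < M →
    Tendsto f (comap UnitDisc.coe (𝓝 ζ) ⊓
      𝓟 {z : 𝔻 | ‖(z : ℂ) - ζ‖ < M * (1 - ‖(z : ℂ)‖)}) (𝓝 L)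

/-- Inner functions: bounded holomorphic functions whose nontangential boundary values exist
and have modulus one at almost every point of the unit circle. -/
def IsInner (θ : 𝔻 → ℂ) : Prop :=
  θ ∈ HInfty ∧ ∀ᵐ t ∂(volume.restrict (Set.Ioc (0 : ℝ) (2 * Real.pi))),
    ∃ L : ℂ, HasNontangentialLimit θ (circleMap 0 1 t) L ∧ ‖L‖ = 1

/-- Holomorphic self-maps of the disc. -/
def IsHolomorphicSelfMap (φ : 𝔻 → 𝔻) : Prop := IsHolomorphic fun z => (φ z : ℂ)

/-- The subspace `θ H²` of `H²`. -/
def mulRange (θ : 𝔻 → ℂ) : Submodule ℂ H2 where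
  carrier := {f | ∃ h : H2, ∀ z, f z = θ z * h z}
  zero_mem' := ⟨0, fun z => by
    change (0 : ℂ) = θ z * 0
    simp⟩
  add_mem' := by
    rintro f g ⟨h, hh⟩ ⟨k, hk⟩
    refine ⟨h + k, fun z => ?_⟩
    change f z + g z = θ z * (h z + k z)
    rw [hh, hk, mul_add]
  smul_mem' := by
    rintro c f ⟨h, hh⟩
    refine ⟨c • h, fun z => ?_⟩
    change c * f z = θ z * (c * h z)
    rw [hh]
    ring

/-- `S ∈ Lat C_φ`: `S` is a closed subspace of `H²` and `C_φ S ⊆ S`, where `C_φ f = f ∘ φ`. -/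
def MemLatComposition (φ : 𝔻 → 𝔻) (S : Submodule ℂ H2) : Prop :=
  IsClosed (S : Set H2) ∧ ∀ f ∈ S, ∃ g ∈ S, (g : 𝔻 → ℂ) = (f : 𝔻 → ℂ) ∘ φ

/-- The quotient `f / g`, a function defined off the zeros of `g`, belongs to the class `A` of
functions on the disc: its singularities are removable and the extension is in `A`. -/
def QuotientMem (f g : 𝔻 → ℂ) (A : Set (𝔻 → ℂ)) : Prop :=
  ∃ ψ ∈ A, ∀ z, g z ≠ 0 → ψ z = f z / g z

end HardyDisc

end

noncomputable section

namespace HardyDisc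

/-! Multiplication by an inner function `θ` is an isometry of `H²` (`IsInner.hardyENorm_mul`). Hence
`θ H²` is closed, and invariance applied to `θ = θ · 1` gives `θ ∘ φ = θ ψ` with `ψ` in `H²`.

Such a `ψ` is automatically bounded by one. Since `|θ ψ| = |θ ∘ φ| ≤ 1`, the isometry gives `‖ψ k‖ =
‖θ ψ k‖ ≤ ‖k‖` for every `k` in `H^∞`. For the Szegő kernel `k` at `w` one has `‖k‖² = k(w)`, so
`|ψ(w)| k(w) ≤ ‖ψ k‖ ‖k‖ ≤ k(w)` (`exists_kernel`, `IsInner.norm_le_one_of_mul`). Conversely, if `ψ`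
is bounded, then `(θ g) ∘ φ = θ ψ (g ∘ φ)` lies in `θ H²`, because `C_φ` preserves `H²` by
Littlewood's subordination principle.

Boundary values are needed only for `θ`: the isometry is proved on polynomials, through the radial
limits of `θ`, and extended by density. Parseval's identity, which turns the `H²` norm into the `ℓ²`
norm of the Taylor coefficients, underlies the density, the completeness and the kernel estimate. -/

/-! ### Fourier series on the circle and Parseval's identity -/

theorem integral_arcMeasure {E : Type*} [NormedAddCommGroup E] [NormedSpace ℝ E] (f : ℝ → E) :
    ∫ t, f t ∂arcMeasure = (2 * Real.pi)⁻¹ • ∫ t in 0..2 * Real.pi, f t := by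
  have h : (0 : ℝ) ≤ (2 * Real.pi)⁻¹ := by positivity
  rw [arcMeasure, integral_smul_measure, intervalIntegral.integral_of_le (by positivity),
    one_div, ENNReal.toReal_ofReal h]

instance : IsProbabilityMeasure arcMeasure where
  measure_univ := by
    rw [arcMeasure, Measure.smul_apply, Measure.restrict_apply_univ, Real.volume_Ioc, smul_eq_mul,
      ← ENNReal.ofReal_mul (by positivity)]
    rw [one_div, sub_zero, inv_mul_cancel₀ Real.two_pi_pos.ne', ENNReal.ofReal_one]

theorem ae_arcMeasure {p : ℝ → Prop}
    (h : ∀ᵐ t ∂(volume.restrict (Set.Ioc (0 : ℝ) (2 * Real.pi))), p t) :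
    ∀ᵐ t ∂arcMeasure, p t :=
  Measure.ae_smul_measure h _

theorem integral_exp_int_mul (m : ℤ) :
    ∫ t : ℝ, exp (m * I * t) ∂arcMeasure = if m = 0 then 1 else 0 := by
  rw [integral_arcMeasure]
  split_ifs with h
  · subst h
    have : (Real.pi : ℂ) ≠ 0 := by simp [Real.pi_ne_zero]
    simp
    field_simp
  · rw [integral_exp_mul_complex (mul_ne_zero (Int.cast_ne_zero.2 h) I_ne_zero)]
    have : exp (m * I * ((2 * Real.pi : ℝ) : ℂ)) = 1 := by
      rw [← exp_int_mul_two_pi_mul_I m]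
      congr 1
      push_cast
      ring
    rw [this]
    simp

theorem norm_exp_mul_I_real (m : ℤ) (t : ℝ) : ‖exp (m * I * t)‖ = 1 := by
  have : (m : ℂ) * I * t = ((m * t : ℝ) : ℂ) * I := by push_cast; ring
  rw [this, norm_exp_ofReal_mul_I]

theorem continuous_tsum_exp {c : ℕ → ℂ} (hc : Summable fun n => ‖c n‖) :
    Continuous fun t : ℝ => ∑' n : ℕ, c n * exp ((n : ℤ) * I * t) :=
  continuous_tsum (fun n => by fun_prop) hc fun n t => by
    rw [norm_mul, norm_exp_mul_I_real, mul_one]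

/-- Absolute summability permits termwise integration, and orthogonality of the exponentials leaves
at most one term. The sum on the right also covers negative `k`, where it is zero. -/
theorem fourierCoeffOn_tsum_exp {c : ℕ → ℂ} (hc : Summable fun n => ‖c n‖) (k : ℤ) :
    fourierCoeffOn Real.two_pi_pos (fun t : ℝ => ∑' n : ℕ, c n * exp ((n : ℤ) * I * t)) k
      = ∑' n : ℕ, if (n : ℤ) = k then c n else 0 := by
  have h1 : fourierCoeffOn Real.two_pi_pos (fun t : ℝ => ∑' n : ℕ, c n * exp ((n : ℤ) * I * t)) k
      = ∫ t : ℝ, ∑' n : ℕ, c n * exp (((n - k : ℤ) : ℂ) * I * t) ∂arcMeasure := by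
    rw [fourierCoeffOn_eq_integral, integral_arcMeasure, one_div, sub_zero]
    congr 2
    funext t
    rw [fourier_coe_apply, smul_eq_mul, ← tsum_mul_left]
    refine tsum_congr fun n => ?_
    rw [mul_left_comm, ← exp_add]
    congr 2
    have : (Real.pi : ℂ) ≠ 0 := by simp [Real.pi_ne_zero]
    push_cast
    field_simp
    ring
  rw [h1]
  have h2 := hasSum_integral_of_summable_integral_norm (μ := arcMeasure)
    (F := fun (n : ℕ) (t : ℝ) => c n * exp (((n - k : ℤ) : ℂ) * I * t)) (fun n => by
      refine Integrable.of_bound (C := ‖c n‖) (Continuous.aestronglyMeasurable (by fun_prop)) ?_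
      exact Eventually.of_forall fun t => by rw [norm_mul, norm_exp_mul_I_real, mul_one])
    (by simpa only [norm_mul, norm_exp_mul_I_real, mul_one, integral_const, probReal_univ,
      one_smul] using hc)
  rw [← h2.tsum_eq]
  refine tsum_congr fun n => ?_
  rw [integral_const_mul, integral_exp_int_mul]
  simp only [sub_eq_zero]
  split_ifs <;> simp

/-- **Parseval's identity** for an absolutely convergent power series on the unit circle. -/
theorem lintegral_enorm_sq_tsum_exp {c : ℕ → ℂ} (hc : Summable fun n => ‖c n‖) :
    ∫⁻ t : ℝ, ‖∑' n : ℕ, c n * exp ((n : ℤ) * I * t)‖ₑ ^ 2 ∂arcMeasure = ∑' n, ‖c n‖ₑ ^ 2 := by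
  set f : ℝ → ℂ := fun t => ∑' n : ℕ, c n * exp ((n : ℤ) * I * t) with hf
  have hcont : Continuous f := continuous_tsum_exp hc
  have hbd : ∀ t, ‖f t‖ ≤ ∑' n, ‖c n‖ := fun t =>
    tsum_of_norm_bounded hc.hasSum fun n => by rw [norm_mul, norm_exp_mul_I_real, mul_one]
  have hP := hasSum_sq_fourierCoeffOn Real.two_pi_pos
    (MemLp.of_bound hcont.aestronglyMeasurable _ (Eventually.of_forall hbd) :
      MemLp f 2 (volume.restrict (Set.Ioc 0 (2 * Real.pi))))
  rw [sub_zero, ← integral_arcMeasure] at hP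
  have hN : HasSum (fun n : ℕ => ‖c n‖ ^ 2) (∫ t, ‖f t‖ ^ 2 ∂arcMeasure) := by
    -- The negative Fourier coefficients vanish, so the sum over `ℤ` reduces to one over `ℕ`.
    rw [← Function.Injective.hasSum_iff (g := fun n : ℕ => (n : ℤ)) Nat.cast_injective] at hP
    · convert hP using 2 with n
      rw [Function.comp_apply, fourierCoeffOn_tsum_exp hc, tsum_eq_single n]
      · simp
      · intro m hm
        simp [hm]
    · intro k hk
      rw [fourierCoeffOn_tsum_exp hc]
      have : ∀ n : ℕ, (n : ℤ) ≠ k := fun n hn => hk ⟨n, hn⟩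
      simp [this]
  have hsq : ∀ z : ℂ, ‖z‖ₑ ^ 2 = ENNReal.ofReal (‖z‖ ^ 2) := fun z => by
    rw [ENNReal.ofReal_pow (norm_nonneg _), ofReal_norm]
  simp only [hsq]
  rw [← ENNReal.ofReal_tsum_of_nonneg (fun n => by positivity) hN.summable, hN.tsum_eq,
    ofReal_integral_eq_lintegral_ofReal]
  · refine Integrable.of_bound (C := (∑' n, ‖c n‖) ^ 2)
      (Continuous.aestronglyMeasurable (by fun_prop)) (Eventually.of_forall fun t => ?_)
    rw [Real.norm_of_nonneg (by positivity)]
    exact pow_le_pow_left₀ (norm_nonneg _) (hbd t) 2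
  · exact Eventually.of_forall fun t => by positivity

/-! ### Integral means and Taylor coefficients -/

theorem circleMean_sq (f : 𝔻 → ℂ) (r : ℝ) :
    circleMean f r ^ 2 = ∫⁻ t : ℝ, ‖extendZero f (circleMap 0 r t)‖ₑ ^ 2 ∂arcMeasure := by
  have := eLpNorm_nnreal_pow_eq_lintegral (μ := arcMeasure) (p := 2)
    (f := fun t : ℝ => extendZero f (circleMap 0 r t)) two_ne_zero
  simpa [circleMean] using this

theorem circleMean_le_hardyENorm (f : 𝔻 → ℂ) {r : ℝ} (hr : r ∈ Set.Ico (0 : ℝ) 1) :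
    circleMean f r ≤ hardyENorm f :=
  le_iSup₂ (f := fun r (_ : r ∈ Set.Ico (0 : ℝ) 1) => circleMean f r) r hr

/-- The power series with coefficients `a` converges to `f` on the disc. -/
def HasTaylor (a : ℕ → ℂ) (f : 𝔻 → ℂ) : Prop :=
  ∀ z : 𝔻, HasSum (fun n => a n * (z : ℂ) ^ n) (f z)

theorem IsHolomorphic.exists_hasTaylor {f : 𝔻 → ℂ} (hf : IsHolomorphic f) :
    ∃ a, HasTaylor a f := by
  refine ⟨fun n => (n.factorial : ℂ)⁻¹ * iteratedDeriv n (extendZero f) 0, fun z => ?_⟩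
  have h := hasSum_taylorSeries_on_ball hf (z := z) (by simpa using z.norm_lt_one)
  rw [extendZero_coe] at h
  refine h.congr_fun fun n => ?_
  simp only [sub_zero, smul_eq_mul]
  ring

theorem HasTaylor.summable_norm {a : ℕ → ℂ} {f : 𝔻 → ℂ} (h : HasTaylor a f) {r : ℝ}
    (hr : r ∈ Set.Ico (0 : ℝ) 1) : Summable fun n => ‖a n * (r : ℂ) ^ n‖ := by
  have := (h (UnitDisc.mk r (by simpa [abs_of_nonneg hr.1] using hr.2))).summable.norm
  simpa using this

theorem HasTaylor.extendZero_circleMap {a : ℕ → ℂ} {f : 𝔻 → ℂ} (h : HasTaylor a f) {r : ℝ}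
    (hr : r ∈ Set.Ico (0 : ℝ) 1) (t : ℝ) :
    extendZero f (circleMap 0 r t) = ∑' n : ℕ, a n * (r : ℂ) ^ n * exp ((n : ℤ) * I * t) := by
  have hz : ‖circleMap 0 r t‖ < 1 := by simpa [abs_of_nonneg hr.1] using hr.2
  rw [extendZero, dif_pos hz, ← (h (UnitDisc.mk _ hz)).tsum_eq]
  refine tsum_congr fun n => ?_
  have : (circleMap 0 r t) ^ n = (r : ℂ) ^ n * exp ((n : ℤ) * I * t) := by
    rw [circleMap_zero, mul_pow, ← exp_nat_mul]
    congr 2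
    push_cast
    ring
  rw [UnitDisc.coe_mk, this, ← mul_assoc]

theorem HasTaylor.circleMean_sq {a : ℕ → ℂ} {f : 𝔻 → ℂ} (h : HasTaylor a f) {r : ℝ}
    (hr : r ∈ Set.Ico (0 : ℝ) 1) :
    circleMean f r ^ 2 = ∑' n, ‖a n * (r : ℂ) ^ n‖ₑ ^ 2 := by
  rw [HardyDisc.circleMean_sq, ← lintegral_enorm_sq_tsum_exp (h.summable_norm hr)]
  simp only [h.extendZero_circleMap hr]

theorem HasTaylor.circleMean_mono {a : ℕ → ℂ} {f : 𝔻 → ℂ} (h : HasTaylor a f) :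
    MonotoneOn (circleMean f) (Set.Ico 0 1) := by
  intro r hr s hs hrs
  rw [← ENNReal.pow_le_pow_left_iff two_ne_zero, h.circleMean_sq hr, h.circleMean_sq hs]
  refine ENNReal.tsum_le_tsum fun n => ?_
  gcongr
  simp only [enorm_le_iff_norm_le, norm_mul, norm_pow, norm_real, Real.norm_of_nonneg hr.1,
    Real.norm_of_nonneg hs.1]
  have := hr.1
  gcongr

/-- The `H²` norm is the `ℓ²` norm of the Taylor coefficients. -/
theorem HasTaylor.hardyENorm_sq {a : ℕ → ℂ} {f : 𝔻 → ℂ} (h : HasTaylor a f) :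
    hardyENorm f ^ 2 = ∑' n, ‖a n‖ₑ ^ 2 := by
  have hmem : ∀ᶠ r : ℝ in 𝓝[<] 1, r ∈ Set.Ico (0 : ℝ) 1 :=
    Ico_mem_nhdsLT (by norm_num)
  apply le_antisymm
  · rw [← ENNReal.rpow_ofNat, ← ENNReal.le_rpow_inv_iff two_pos]
    refine iSup₂_le fun r hr => ?_
    rw [ENNReal.le_rpow_inv_iff two_pos, ENNReal.rpow_ofNat, h.circleMean_sq hr]
    refine ENNReal.tsum_le_tsum fun n => ?_
    gcongr
    simp only [enorm_le_iff_norm_le, norm_mul, norm_pow, norm_real, Real.norm_of_nonneg hr.1]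
    exact mul_le_of_le_one_right (norm_nonneg _) (pow_le_one₀ hr.1 hr.2.le)
  -- Let `r → 1` in a finite partial sum, each of which is dominated by the squared mean at radius
  -- `r`.
  · refine ENNReal.tsum_le_of_sum_range_le fun N => ?_
    have ht : Tendsto (fun r : ℝ => ∑ n ∈ Finset.range N, ‖a n * (r : ℂ) ^ n‖ₑ ^ 2) (𝓝[<] 1)
        (𝓝 (∑ n ∈ Finset.range N, ‖a n‖ₑ ^ 2)) := by
      refine tendsto_nhdsWithin_of_tendsto_nhds ?_
      have : Continuous (fun r : ℝ => ∑ n ∈ Finset.range N, ‖a n * (r : ℂ) ^ n‖ₑ ^ 2) :=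
        continuous_finsetSum _ fun n _ => (ENNReal.continuous_pow 2).comp (by fun_prop)
      simpa using this.tendsto 1
    refine le_of_tendsto ht (hmem.mono fun r hr => ?_)
    refine (ENNReal.sum_le_tsum _).trans ?_
    rw [← h.circleMean_sq hr]
    gcongr
    exact circleMean_le_hardyENorm f hr

/-- The means increase with the radius, so their supremum is a limit; this makes the norm accessible
to limit theorems at the boundary. -/
theorem IsHolomorphic.tendsto_circleMean {f : 𝔻 → ℂ} (hf : IsHolomorphic f) :
    Tendsto (circleMean f) (𝓝[<] 1) (𝓝 (hardyENorm f)) := by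
  obtain ⟨a, h⟩ := hf.exists_hasTaylor
  refine tendsto_order.2 ⟨fun b hb => ?_, fun b hb => ?_⟩
  · simp only [hardyENorm, lt_iSup_iff] at hb
    obtain ⟨r, hr, hb⟩ := hb
    filter_upwards [Ico_mem_nhdsLT hr.2] with s hs
    exact hb.trans_le (h.circleMean_mono hr ⟨hr.1.trans hs.1, hs.2⟩ hs.1)
  · filter_upwards [Ico_mem_nhdsLT (show (0 : ℝ) < 1 by norm_num)] with s hs
    exact (circleMean_le_hardyENorm f hs).trans_lt hb

/-- Cauchy–Schwarz between the Taylor coefficients and the powers of `w`. -/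
theorem HasTaylor.enorm_sq_le {a : ℕ → ℂ} {f : 𝔻 → ℂ} (h : HasTaylor a f) (w : 𝔻) :
    ‖f w‖ₑ ^ 2 ≤ hardyENorm f ^ 2 * ∑' n, ‖(w : ℂ) ^ n‖ₑ ^ 2 := by
  have h1 : ‖f w‖ₑ ≤ ∑' n, ‖a n‖ₑ * ‖(w : ℂ) ^ n‖ₑ := by
    rw [← (h w).tsum_eq]
    refine (enorm_tsum_le_tsum_enorm).trans_eq (tsum_congr fun n => enorm_mul _ _)
  have h2 := ENNReal.lintegral_mul_le_Lp_mul_Lq (Measure.count : Measure ℕ)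
    Real.HolderConjugate.two_two (f := fun n => ‖a n‖ₑ) (g := fun n => ‖(w : ℂ) ^ n‖ₑ)
    measurable_from_nat.aemeasurable measurable_from_nat.aemeasurable
  simp only [lintegral_count, Pi.mul_apply, ENNReal.rpow_ofNat] at h2
  rw [h.hardyENorm_sq]
  calc ‖f w‖ₑ ^ 2 ≤ _ := pow_le_pow_left₀ zero_le (h1.trans h2) 2
    _ = _ := by
      rw [mul_pow, ← ENNReal.rpow_natCast, ← ENNReal.rpow_natCast, ← ENNReal.rpow_mul,
        ← ENNReal.rpow_mul]
      norm_num

/-! ### Operations on holomorphic functions of the disc -/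

theorem isHolomorphic_of_eq {f : 𝔻 → ℂ} {F : ℂ → ℂ} (hF : DifferentiableOn ℂ F (Metric.ball 0 1))
    (h : ∀ z : 𝔻, f z = F z) : IsHolomorphic f :=
  hF.congr fun z hz => by
    have hz' : ‖z‖ < 1 := by simpa using hz
    rw [extendZero, dif_pos hz', h, UnitDisc.coe_mk]

theorem extendZero_mul (f g : 𝔻 → ℂ) : extendZero (f * g) = extendZero f * extendZero g := by
  funext z
  by_cases h : ‖z‖ < 1 <;> simp [extendZero, h]

theorem IsHolomorphic.mul {f g : 𝔻 → ℂ} (hf : IsHolomorphic f) (hg : IsHolomorphic g) :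
    IsHolomorphic (f * g) := by
  unfold IsHolomorphic
  rw [extendZero_mul]
  exact DifferentiableOn.mul hf hg

theorem IsHolomorphic.sub {f g : 𝔻 → ℂ} (hf : IsHolomorphic f) (hg : IsHolomorphic g) :
    IsHolomorphic (f - g) := by
  have h : f - g = f + (-1 : ℂ) • g := by rw [neg_one_smul, sub_eq_add_neg]
  unfold IsHolomorphic
  rw [h, extendZero_add, extendZero_smul]
  exact DifferentiableOn.add hf (DifferentiableOn.const_smul hg _)

theorem isHolomorphic_const (c : ℂ) : IsHolomorphic fun _ => c :=
  isHolomorphic_of_eq (F := fun _ => c) (differentiableOn_const c) fun _ => rfl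

theorem IsHolomorphicSelfMap.comp {φ : 𝔻 → 𝔻} (hφ : IsHolomorphicSelfMap φ) {f : 𝔻 → ℂ}
    (hf : IsHolomorphic f) : IsHolomorphic (f ∘ φ) := by
  refine isHolomorphic_of_eq (F := extendZero f ∘ extendZero fun z => (φ z : ℂ))
    (DifferentiableOn.comp hf hφ fun z hz => ?_) fun z => ?_
  · have hz' : ‖z‖ < 1 := by simpa using hz
    rw [extendZero, dif_pos hz']
    simpa using (φ _).norm_lt_one
  · rw [Function.comp_apply, Function.comp_apply, extendZero_coe, extendZero_coe]

/-- A product of holomorphic functions on the disc vanishes only if one of the factors does. -/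
theorem IsHolomorphic.eq_zero_or_eq_zero_of_mul_eq_zero {f g : 𝔻 → ℂ} (hf : IsHolomorphic f)
    (hg : IsHolomorphic g) (h : f * g = 0) : f = 0 ∨ g = 0 := by
  have hU : IsPreconnected (Metric.ball (0 : ℂ) 1) := (convex_ball 0 1).isPreconnected
  have := AnalyticOnNhd.eq_zero_or_eq_zero_of_mul_eq_zero
    (DifferentiableOn.analyticOnNhd hf Metric.isOpen_ball)
    (DifferentiableOn.analyticOnNhd hg Metric.isOpen_ball) (fun z _ => by
      have := congrFun (extendZero_mul f g) z
      rw [h, extendZero_zero] at this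
      exact this.symm) hU
  refine this.imp (fun H => ?_) fun H => ?_ <;>
  · funext z
    have := H z (by simpa using z.norm_lt_one)
    rwa [extendZero_coe] at this

/-! ### `H²` as `ℓ²`, and its completeness -/

/-- A power series with bounded coefficients is holomorphic on the disc. -/
theorem exists_hasTaylor_of_bounded {a : ℕ → ℂ} {C : ℝ} (ha : ∀ n, ‖a n‖ ≤ C) :
    ∃ f, IsHolomorphic f ∧ HasTaylor a f := by
  have hsum : ∀ z : ℂ, ‖z‖ < 1 → Summable fun n => a n * z ^ n := fun z hz =>
    Summable.of_norm_bounded ((summable_geometric_of_lt_one (norm_nonneg z) hz).mul_left C)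
      fun n => by
        rw [norm_mul, norm_pow]
        exact mul_le_mul_of_nonneg_right (ha n) (by positivity)
  refine ⟨fun z => ∑' n, a n * (z : ℂ) ^ n, isHolomorphic_of_eq
    (F := fun z => ∑' n, a n * z ^ n) (fun z hz => ?_) fun z => rfl,
    fun z => (hsum z z.norm_lt_one).hasSum⟩
  -- The series is dominated by a geometric one only on smaller discs, so differentiability at `z`
  -- is checked on a disc of radius `r` between `‖z‖` and `1`.
  obtain ⟨r, hzr, hr⟩ := exists_between (show ‖z‖ < 1 by simpa using hz)
  have hr0 : 0 ≤ r := (norm_nonneg z).trans hzr.le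
  have hd : DifferentiableOn ℂ (fun z => ∑' n, a n * z ^ n) (Metric.ball 0 r) := by
    refine differentiableOn_tsum_of_summable_norm
      ((summable_geometric_of_lt_one hr0 hr).mul_left C) (fun n => by fun_prop)
      Metric.isOpen_ball fun n w hw => ?_
    rw [norm_mul, norm_pow]
    have hw' : ‖w‖ ≤ r := by simpa using (Metric.mem_ball.1 hw).le
    have := (norm_nonneg _).trans (ha n)
    gcongr
    exact ha n
  exact (hd.differentiableAt 
    (Metric.isOpen_ball.mem_nhds (by simpa using hzr))).differentiableWithinAt

theorem memℓp_two_iff {a : ℕ → ℂ} : Memℓp a 2 ↔ ∑' n, ‖a n‖ₑ ^ 2 ≠ ∞ := by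
  rw [memℓp_gen_iff (by norm_num)]
  have : ∀ n, ‖a n‖ₑ ^ 2 = ((‖a n‖₊ ^ 2 : NNReal) : ℝ≥0∞) := fun n => by
    rw [ENNReal.coe_pow, enorm_eq_nnnorm]
  simp only [this, ENNReal.tsum_coe_ne_top_iff_summable, ← NNReal.summable_coe]
  simp

theorem H2.norm_sq_eq {f : H2} {a : ℕ → ℂ} (h : HasTaylor a f) :
    ‖f‖ ^ 2 = ∑' n, ‖a n‖ ^ 2 := by
  change (hardyENorm f.1).toReal ^ 2 = _
  rw [← ENNReal.toReal_pow, h.hardyENorm_sq, ENNReal.tsum_toReal_eq (by simp)]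
  simp

theorem hardyENorm_lt_top_of_memℓp {f : 𝔻 → ℂ} {a : ℕ → ℂ} (h : HasTaylor a f)
    (ha : Memℓp a 2) : hardyENorm f < ∞ := by
  rw [memℓp_two_iff, ← h.hardyENorm_sq] at ha
  exact lt_top_iff_ne_top.2 fun h' => ha (by simp [h'])

/-- The function in `H²` with given square summable Taylor coefficients. -/
theorem exists_H2_hasTaylor (a : lp (fun _ : ℕ => ℂ) 2) : ∃ f : H2, HasTaylor a f := by
  obtain ⟨f, hf, ha⟩ := exists_hasTaylor_of_bounded fun n => lp.norm_apply_le_norm two_ne_zero a n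
  exact ⟨⟨f, hf, hardyENorm_lt_top_of_memℓp ha (lp.memℓp a)⟩, ha⟩

/-- Summing power series is an isometry of the complete space `ℓ²` onto `H2`. -/
instance : CompleteSpace H2 := by
  choose T hT using exists_H2_hasTaylor
  have hadd : ∀ a b, T (a - b) = T a - T b := fun a b => Subtype.ext <| funext fun z =>
    (hT (a - b) z).unique <|
      ((hT a z).sub (hT b z)).congr_fun fun n => by simp [sub_mul]
  have hiso : Isometry T := Isometry.of_dist_eq fun a b => by
    rw [dist_eq_norm, dist_eq_norm, ← hadd, ← sq_eq_sq₀ (norm_nonneg _) (norm_nonneg _),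
      H2.norm_sq_eq (hT _)]
    have := lp.norm_rpow_eq_tsum (p := 2) (by norm_num) (a - b)
    simpa using this.symm
  have hsurj : Set.range T = Set.univ := by
    refine Set.eq_univ_of_forall fun f => ?_
    obtain ⟨a, ha⟩ := f.2.1.exists_hasTaylor
    have hmem : Memℓp a 2 := by
      rw [memℓp_two_iff, ← ha.hardyENorm_sq]
      exact ENNReal.pow_ne_top f.2.2.ne
    exact ⟨⟨a, hmem⟩, Subtype.ext <| funext fun z => (hT _ z).unique (ha z)⟩
  rw [completeSpace_iff_isComplete_univ, ← hsurj]
  exact hiso.isUniformInducing.isComplete_range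

/-! ### Bounded functions as multipliers -/

theorem circleMean_mul_le {g f : 𝔻 → ℂ} {C : ℝ} (hg : ∀ z, ‖g z‖ ≤ C) (r : ℝ) :
    circleMean (g * f) r ≤ ENNReal.ofReal C * circleMean f r := by
  unfold circleMean
  rw [extendZero_mul]
  refine eLpNorm_le_mul_eLpNorm_of_ae_le_mul (Eventually.of_forall fun t => ?_) 2
  rw [Pi.mul_apply, norm_mul]
  refine mul_le_mul_of_nonneg_right ?_ (norm_nonneg _)
  unfold extendZero
  split_ifs
  · exact hg _
  -- Off the disc the extension is `0`; `0 ≤ C` follows from the bound at the centre.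
  · exact norm_zero.trans_le ((norm_nonneg _).trans (hg 0))

theorem hardyENorm_mul_le {g : 𝔻 → ℂ} {C : ℝ} (hg : ∀ z, ‖g z‖ ≤ C) (f : 𝔻 → ℂ) :
    hardyENorm (g * f) ≤ ENNReal.ofReal C * hardyENorm f :=
  iSup₂_le fun r hr => (circleMean_mul_le hg r).trans (by
    gcongr
    exact circleMean_le_hardyENorm f hr)

theorem mul_mem_hardySpace {g f : 𝔻 → ℂ} (hg : g ∈ HInfty) (hf : f ∈ hardySpace) :
    g * f ∈ hardySpace := by
  obtain ⟨hg, C, hC⟩ := hg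
  exact ⟨hg.mul hf.1, (hardyENorm_mul_le hC f).trans_lt
    (ENNReal.mul_lt_top ENNReal.ofReal_lt_top hf.2)⟩

theorem one_mem_hardySpace : (1 : 𝔻 → ℂ) ∈ hardySpace := by
  refine ⟨isHolomorphic_const 1, ?_⟩
  have h : HasTaylor (fun n => if n = 0 then 1 else 0) 1 := fun z => by
    convert hasSum_single (f := fun n => (if n = 0 then 1 else 0) * (z : ℂ) ^ n) 0 ?_ using 1
    · simp
    · simp +contextual
  refine hardyENorm_lt_top_of_memℓp h ?_
  rw [memℓp_two_iff, tsum_eq_single 0 (by simp +contextual)]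
  simp

theorem HInfty_subset_hardySpace : HInfty ⊆ (hardySpace : Set (𝔻 → ℂ)) := fun g hg => by
  simpa using mul_mem_hardySpace hg one_mem_hardySpace

/-! ### Inner functions act isometrically -/

theorem extendZero_circleMap {f : 𝔻 → ℂ} {r : ℝ} (hr : r ∈ Set.Ico (0 : ℝ) 1) (t : ℝ) :
    ∃ z : 𝔻, (z : ℂ) = circleMap 0 r t ∧ extendZero f (circleMap 0 r t) = f z := by
  have hz : ‖circleMap 0 r t‖ < 1 := by simpa [abs_of_nonneg hr.1] using hr.2
  exact ⟨UnitDisc.mk _ hz, rfl, dif_pos hz⟩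

/-- A nontangential limit is in particular a radial limit. -/
theorem HasNontangentialLimit.tendsto_radial {f : 𝔻 → ℂ} {t : ℝ} {L : ℂ}
    (h : HasNontangentialLimit f (circleMap 0 1 t) L) :
    Tendsto (fun r : ℝ => extendZero f (circleMap 0 r t)) (𝓝[<] 1) (𝓝 L) := by
  rw [tendsto_nhds]
  intro s hs hL
  -- On the radius `|z - ζ| = 1 - |z|`, so it lies in the approach region of any aperture `M > 1`.
  have h2 := h 2 one_lt_two (hs.mem_nhds hL)
  rw [mem_map, mem_inf_principal, mem_comap] at h2
  obtain ⟨U, hU, hUs⟩ := h2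
  have hc : Continuous fun r : ℝ => circleMap 0 r t := by unfold circleMap; fun_prop
  filter_upwards [nhdsWithin_le_nhds (hc.continuousAt.preimage_mem_nhds hU),
    Ico_mem_nhdsLT (show (0 : ℝ) < 1 by norm_num)] with r hrU hr
  obtain ⟨z, hz, hfz⟩ := extendZero_circleMap (f := f) hr t
  rw [Set.mem_preimage, hfz]
  refine hUs (show (z : ℂ) ∈ U from hz ▸ hrU) ?_
  have h3 : (z : ℂ) - circleMap 0 1 t = ((r - 1 : ℝ) : ℂ) * exp (t * I) := by
    rw [hz, circleMap_zero, circleMap_zero]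
    push_cast
    ring
  have h4 : ‖(z : ℂ)‖ = r := by rw [hz, norm_circleMap_zero, abs_of_nonneg hr.1]
  have := hr.2
  rw [Set.mem_ofPred_eq, h3, h4, norm_mul, norm_exp_ofReal_mul_I, norm_real, mul_one,
    Real.norm_of_nonpos (by linarith)]
  linarith

theorem isInner_one : IsInner 1 :=
  ⟨⟨isHolomorphic_const 1, 1, fun _ => by simp⟩, Eventually.of_forall fun _ =>
    ⟨1, fun _ _ => tendsto_const_nhds, norm_one⟩⟩

/-- Dominated convergence along the radii: at almost every boundary point `θ` tends to a limit of
modulus one, and `F` is continuous up to the circle. The right side does not involve `θ`, so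
comparison with `θ = 1` yields the isometry for such functions. -/
theorem hardyENorm_sq_inner_mul_of_continuous {θ f : 𝔻 → ℂ} {F : ℂ → ℂ} (hθ : IsInner θ)
    (hf : IsHolomorphic f) (hF : Continuous F) (hfF : ∀ z : 𝔻, f z = F z) :
    hardyENorm (θ * f) ^ 2 = ∫⁻ t : ℝ, ‖F (circleMap 0 1 t)‖ₑ ^ 2 ∂arcMeasure := by
  obtain ⟨⟨hθh, C, hC⟩, hθL⟩ := hθ
  obtain ⟨B, hB⟩ := (isCompact_closedBall (0 : ℂ) 1).exists_bound_of_continuousOn hF.continuousOn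
  have hprod := hθh.mul hf
  have hIco := Ico_mem_nhdsLT (show (0 : ℝ) < 1 by norm_num)
  refine tendsto_nhds_unique ((ENNReal.continuous_pow 2).continuousAt.tendsto.comp
    hprod.tendsto_circleMean) ?_
  simp only [Function.comp_def, circleMean_sq]
  -- `C` bounds `θ` on the disc and `B` bounds `F` on the closed disc.
  refine tendsto_lintegral_filter_of_dominated_convergence
    (fun _ => ENNReal.ofReal (C * B) ^ 2) ?_ ?_ ?_ ?_
  · filter_upwards [hIco] with r hr
    exact ((ENNReal.continuous_pow 2).comp (hprod.continuous_circle hr).enorm).measurable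
  · filter_upwards [hIco] with r hr
    refine Eventually.of_forall fun t => ?_
    obtain ⟨z, -, hz⟩ := extendZero_circleMap (f := θ * f) hr t
    rw [hz, ← ofReal_norm]
    gcongr
    rw [Pi.mul_apply, norm_mul, hfF]
    have := (norm_nonneg _).trans (hC z)
    gcongr
    · exact hC z
    · exact hB _ (by simpa using z.norm_lt_one.le)
  · simp
  · filter_upwards [ae_arcMeasure hθL] with t ⟨L, hL, hL1⟩
    have hc : Continuous fun r : ℝ => F (circleMap 0 r t) :=
      hF.comp (by unfold circleMap; fun_prop)
    have h1 : Tendsto (fun r : ℝ => extendZero (θ * f) (circleMap 0 r t)) (𝓝[<] 1)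
        (𝓝 (L * F (circleMap 0 1 t))) := by
      refine (hL.tendsto_radial.mul (hc.continuousAt.mono_left nhdsWithin_le_nhds)).congr' ?_
      filter_upwards [hIco] with r hr
      rw [extendZero_mul, Pi.mul_apply]
      obtain ⟨z, hz, hfz⟩ := extendZero_circleMap (f := f) hr t
      rw [hfz, hfF, hz]
    have h2 := ((ENNReal.continuous_pow 2).comp continuous_enorm).continuousAt.tendsto.comp h1
    have h3 : ‖L * F (circleMap 0 1 t)‖ₑ = ‖F (circleMap 0 1 t)‖ₑ := by
      rw [enorm_mul, ← ofReal_norm, hL1, ENNReal.ofReal_one, one_mul]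
    simpa only [Function.comp_def, h3] using h2

theorem hardyENorm_inner_mul_of_continuous {θ f : 𝔻 → ℂ} {F : ℂ → ℂ} (hθ : IsInner θ)
    (hf : IsHolomorphic f) (hF : Continuous F) (hfF : ∀ z : 𝔻, f z = F z) :
    hardyENorm (θ * f) = hardyENorm f := by
  have h1 := hardyENorm_sq_inner_mul_of_continuous hθ hf hF hfF
  rw [← hardyENorm_sq_inner_mul_of_continuous isInner_one hf hF hfF, one_mul] at h1
  exact (ENNReal.pow_right_strictMono two_ne_zero).injective h1

/-- The Taylor polynomials of a function. -/
def taylorSum (a : ℕ → ℂ) (N : ℕ) (z : ℂ) : ℂ := ∑ n ∈ Finset.range N, a n * z ^ n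

theorem differentiable_taylorSum (a : ℕ → ℂ) (N : ℕ) : Differentiable ℂ (taylorSum a N) := by
  unfold taylorSum
  fun_prop

theorem isHolomorphic_taylorSum (a : ℕ → ℂ) (N : ℕ) :
    IsHolomorphic fun z => taylorSum a N z :=
  isHolomorphic_of_eq (differentiable_taylorSum a N).differentiableOn fun _ => rfl

theorem hasTaylor_taylorSum (a : ℕ → ℂ) (N : ℕ) :
    HasTaylor (fun n => if n < N then a n else 0) fun z => taylorSum a N z := fun z => by
  unfold taylorSum
  convert hasSum_sum_of_ne_finset_zero (s := Finset.range N)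
    (f := fun n => (if n < N then a n else 0) * (z : ℂ) ^ n) ?_ using 1
  · exact Finset.sum_congr rfl fun n hn => by rw [if_pos (Finset.mem_range.1 hn)]
  · intro n hn
    rw [if_neg (by simpa using hn), zero_mul]
  · infer_instance

/-- The Taylor polynomials of a function in `H²` converge to it in norm. -/
theorem HasTaylor.tendsto_hardyENorm_sub {a : ℕ → ℂ} {f : 𝔻 → ℂ} (h : HasTaylor a f)
    (hf : hardyENorm f ≠ ∞) :
    Tendsto (fun N => hardyENorm (f - fun z : 𝔻 => taylorSum a N z)) atTop (𝓝 0) := by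
  have hfin : ∑' n, ‖a n‖ₑ ^ 2 ≠ ∞ := by
    rw [← h.hardyENorm_sq]
    exact ENNReal.pow_ne_top hf
  have hsq : ∀ N, hardyENorm (f - fun z : 𝔻 => taylorSum a N z) ^ 2
      = ∑' n : { n // n ∉ Finset.range N }, ‖a n‖ₑ ^ 2 := fun N => by
    have hT : HasTaylor (fun n => if n < N then 0 else a n)
        (f - fun z : 𝔻 => taylorSum a N z) := fun z =>
      ((h z).sub (hasTaylor_taylorSum a N z)).congr_fun fun n => by beta_reduce; split_ifs <;> simp
    rw [hT.hardyENorm_sq, ← tsum_subtype_eq_of_support_subset (s := {n | n ∉ Finset.range N})]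
    · exact tsum_congr fun n => by rw [if_neg (by simpa using n.2)]
    · intro n hn
      by_contra hn'
      simp_all
  have h0 := (ENNReal.tendsto_tsum_compl_atTop_zero hfin).comp tendsto_finset_range
  simp only [Function.comp_def, ← hsq] at h0
  have := ((ENNReal.continuous_rpow_const (y := (2 : ℝ)⁻¹)).tendsto 0).comp h0
  rw [ENNReal.zero_rpow_of_pos (by norm_num)] at this
  refine this.congr fun N => ?_
  rw [Function.comp_apply, ← ENNReal.rpow_ofNat, ENNReal.rpow_rpow_inv two_ne_zero]

/-- Multiplication by an inner function is isometric on `H²`. -/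
theorem IsInner.hardyENorm_mul {θ f : 𝔻 → ℂ} (hθ : IsInner θ) (hf : f ∈ hardySpace) :
    hardyENorm (θ * f) = hardyENorm f := by
  obtain ⟨a, ha⟩ := hf.1.exists_hasTaylor
  obtain ⟨⟨hθh, C, hC⟩, -⟩ := id hθ
  set p : ℕ → 𝔻 → ℂ := fun N z => taylorSum a N z
  have hp : ∀ N, IsHolomorphic (p N) := isHolomorphic_taylorSum a
  have hpn : ∀ N, hardyENorm (θ * p N) = hardyENorm (p N) := fun N =>
    hardyENorm_inner_mul_of_continuous hθ (hp N) (differentiable_taylorSum a N).continuous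
      fun _ => rfl
  have hd : ∀ N, hardyENorm (p N - f) = hardyENorm (f - p N) := fun N => by
    rw [← neg_sub f, ← neg_one_smul ℂ, hardyENorm_smul]
    simp
  -- Both inequalities below incur the same error `(1 + C) ‖f - p_N‖`, which tends to zero.
  have hlim : ∀ x : ℝ≥0∞, Tendsto (fun N => x + (1 + ENNReal.ofReal C) * hardyENorm (f - p N))
      atTop (𝓝 x) := fun x => by
    have h1 := ENNReal.Tendsto.const_mul (a := 1 + ENNReal.ofReal C)
      (ha.tendsto_hardyENorm_sub hf.2.ne) (Or.inr (by simp))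
    simpa using h1.const_add x
  refine le_antisymm (ge_of_tendsto' (hlim _) fun N => ?_) (ge_of_tendsto' (hlim _) fun N => ?_)
  · calc hardyENorm (θ * f) = hardyENorm (θ * p N + θ * (f - p N)) := by
          rw [← mul_add, add_sub_cancel]
      _ ≤ hardyENorm (p N) + ENNReal.ofReal C * hardyENorm (f - p N) := by
          rw [← hpn N]
          exact (hardyENorm_add_le (hθh.mul (hp N)) (hθh.mul (hf.1.sub (hp N)))).trans
            (add_le_add_right (hardyENorm_mul_le hC _) _)
      _ ≤ (hardyENorm f + hardyENorm (f - p N)) + ENNReal.ofReal C * hardyENorm (f - p N) := by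
          gcongr
          have := hardyENorm_add_le hf.1 ((hp N).sub hf.1)
          rwa [add_sub_cancel, hd] at this
      _ = _ := by ring
  · calc hardyENorm f ≤ hardyENorm (p N) + hardyENorm (f - p N) := by
          have := hardyENorm_add_le (hp N) (hf.1.sub (hp N))
          rwa [add_sub_cancel] at this
      _ ≤ (hardyENorm (θ * f) + ENNReal.ofReal C * hardyENorm (f - p N))
            + hardyENorm (f - p N) := by
          gcongr
          rw [← hpn N, ← hd N]
          have := hardyENorm_add_le (hθh.mul hf.1) (hθh.mul ((hp N).sub hf.1))
          rw [← mul_add, add_sub_cancel] at this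
          exact this.trans (add_le_add_right (hardyENorm_mul_le hC _) _)
      _ = _ := by ring

/-! ### Reproducing kernels and pointwise bounds -/

/-- The reproducing kernels of `H²` bound the pointwise values: a function which multiplies each
of them contractively is bounded by one. -/
theorem exists_kernel (w : 𝔻) : ∃ k ∈ HInfty, ∀ F : 𝔻 → ℂ, IsHolomorphic F →
    hardyENorm (F * k) ≤ hardyENorm k → ‖F w‖ ≤ 1 := by
  have hw : ‖(w : ℂ)‖ < 1 := w.norm_lt_one
  -- These are the coefficients of the Szegő kernel `k(z) = 1 / (1 - w̄ z)`, for which `‖k‖² = k(w)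
  -- = S`.
  set a : ℕ → ℂ := fun n => (starRingEnd ℂ) (w : ℂ) ^ n with ha
  have hna : ∀ n, ‖a n‖ = ‖(w : ℂ)‖ ^ n := fun n => by simp [ha]
  obtain ⟨k, hk, hak⟩ := exists_hasTaylor_of_bounded (a := a) (C := 1) fun n => by
    rw [hna]
    exact pow_le_one₀ (norm_nonneg _) hw.le
  set S : ℝ≥0∞ := ∑' n, ‖(w : ℂ) ^ n‖ₑ ^ 2 with hS
  have hkS : hardyENorm k ^ 2 = S := by
    rw [hak.hardyENorm_sq]
    refine tsum_congr fun n => ?_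
    rw [← ofReal_norm, hna, ← norm_pow, ofReal_norm]
  have hsum2 : Summable fun n => (‖(w : ℂ)‖ ^ n) ^ 2 := by
    simp only [← pow_mul, mul_comm _ 2]
    simp only [pow_mul]
    exact summable_geometric_of_lt_one (by positivity)
      (pow_lt_one₀ (norm_nonneg _) hw two_ne_zero)
  have hkw : ‖k w‖ₑ = S := by
    have h1 : k w = ((∑' n, (‖(w : ℂ)‖ ^ n) ^ 2 : ℝ) : ℂ) := by
      rw [← (hak w).tsum_eq, ofReal_tsum]
      refine tsum_congr fun n => ?_
      rw [ha, ← mul_pow, conj_mul']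
      push_cast
      ring
    rw [h1, ← ofReal_norm, norm_real, Real.norm_of_nonneg (tsum_nonneg fun n => by positivity),
      ENNReal.ofReal_tsum_of_nonneg (fun n => by positivity) hsum2]
    refine tsum_congr fun n => ?_
    rw [ENNReal.ofReal_pow (by positivity), ← norm_pow, ofReal_norm]
  have hStop : S ≠ ∞ := hkw ▸ enorm_ne_top
  have hS0 : S ≠ 0 := by
    refine (lt_of_lt_of_le (by simp) (ENNReal.le_tsum 0)).ne'
  refine ⟨k, ⟨hk, (1 - ‖(w : ℂ)‖)⁻¹, fun z => ?_⟩, fun F hF hFk => ?_⟩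
  · rw [← (hak z).tsum_eq]
    refine tsum_of_norm_bounded (hasSum_geometric_of_lt_one (norm_nonneg _) hw) fun n => ?_
    rw [norm_mul, hna, norm_pow]
    exact mul_le_of_le_one_right (by positivity) (pow_le_one₀ (norm_nonneg _) z.norm_lt_one.le)
  · obtain ⟨b, hb⟩ := (hF.mul hk).exists_hasTaylor
    have h1 := hb.enorm_sq_le w
    rw [Pi.mul_apply, enorm_mul, hkw, ← hS, mul_pow] at h1
    -- `|F(w) k(w)|² ≤ ‖F k‖² S ≤ ‖k‖² S = S²`.
    have h2 : ‖F w‖ₑ ^ 2 * S ^ 2 ≤ 1 * S ^ 2 := by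
      refine h1.trans ?_
      rw [one_mul, sq S]
      gcongr
      rw [← hkS]
      gcongr
    have h3 := (ENNReal.mul_le_mul_iff_left (pow_ne_zero 2 hS0) (ENNReal.pow_ne_top hStop)).1 h2
    have h4 : ‖F w‖ₑ ≤ 1 := by
      by_contra h
      exact absurd h3 (not_le.2 (one_lt_pow₀ (not_le.1 h) two_ne_zero))
    simpa [← ofReal_norm] using h4

/-- The definition provides only some bound. The constant one comes from testing the isometric
multiplier `θ` on the kernels. -/
theorem IsInner.norm_le_one {θ : 𝔻 → ℂ} (hθ : IsInner θ) (w : 𝔻) : ‖θ w‖ ≤ 1 := by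
  obtain ⟨k, hk, hkF⟩ := exists_kernel w
  exact hkF θ hθ.1.1 (hθ.hardyENorm_mul (HInfty_subset_hardySpace hk)).le

theorem IsInner.ne_zero {θ : 𝔻 → ℂ} (hθ : IsInner θ) : θ ≠ 0 := by
  rintro rfl
  have h := hθ.hardyENorm_mul one_mem_hardySpace
  rw [zero_mul, hardyENorm_zero] at h
  exact one_ne_zero (congrFun (eq_zero_of_hardyENorm_eq_zero (isHolomorphic_const 1) h.symm) 0)

/-- If the product of an inner function and an `H²` function is bounded by one, so is the
`H²` function. -/
theorem IsInner.norm_le_one_of_mul {θ ψ : 𝔻 → ℂ} (hθ : IsInner θ) (hψ : ψ ∈ hardySpace)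
    (h : ∀ z, ‖(θ * ψ) z‖ ≤ 1) (w : 𝔻) : ‖ψ w‖ ≤ 1 := by
  obtain ⟨k, hk, hkF⟩ := exists_kernel w
  refine hkF ψ hψ.1 ?_
  -- Inserting `θ` does not change the norm of `ψ k`, and `θ ψ` is a contractive multiplier.
  rw [← hθ.hardyENorm_mul (mul_comm k ψ ▸ mul_mem_hardySpace hk hψ), ← mul_assoc]
  simpa using hardyENorm_mul_le h k

/-! ### Poisson kernel and Littlewood subordination -/

/-- The Poisson kernel of the disc, at the point `e^{is}` of the circle. -/
def discKernel (w : ℂ) (s : ℝ) : ℝ := poissonKernel 0 w (circleMap 0 1 s)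

theorem circleMap_sub_ne_zero {w : ℂ} (hw : ‖w‖ < 1) (s : ℝ) : circleMap 0 1 s - w ≠ 0 := by
  intro h
  have := norm_circleMap_zero 1 s
  rw [sub_eq_zero.1 h, abs_one] at this
  exact hw.ne this

theorem discKernel_nonneg {w : ℂ} (hw : ‖w‖ < 1) (s : ℝ) : 0 ≤ discKernel w s := by
  have : ‖w‖ ^ 2 ≤ 1 := pow_le_one₀ (norm_nonneg _) hw.le
  refine div_nonneg ?_ (by positivity)
  simpa using this

theorem continuous_discKernel {w : ℝ → ℂ} (hw : Continuous w) (hw1 : ∀ t, ‖w t‖ < 1) :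
    Continuous fun x : ℝ × ℝ => discKernel (w x.1) x.2 := by
  unfold discKernel poissonKernel
  refine Continuous.div (by fun_prop) (by fun_prop) fun x => ?_
  have := circleMap_sub_ne_zero (hw1 x.1) x.2
  simpa using this

/-- Harnack's bound, uniform in `s`; it supplies the constant in the subordination principle. -/
theorem discKernel_le {w : ℂ} (hw : ‖w‖ < 1) (s : ℝ) :
    discKernel w s ≤ (1 + ‖w‖) / (1 - ‖w‖) := by
  have := re_herglotzRieszKernel_le (c := 0) (R := 1) (z := circleMap 0 1 s) (w := w)
    (by simp) (by simpa using hw)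
  rw [discKernel, poissonKernel_eq_re_herglotzRieszKernel, Function.comp_apply,
    herglotzRieszKernel_def]
  simpa using this

/-- Subharmonicity: the Poisson integral of `|p|²` majorizes `|p|²`. -/
theorem enorm_sq_le_lintegral_discKernel {p : ℂ → ℂ} (hp : Differentiable ℂ p) {w : ℂ}
    (hw : ‖w‖ < 1) :
    ‖p w‖ₑ ^ 2 ≤ ∫⁻ s : ℝ, ‖p (circleMap 0 1 s)‖ₑ ^ 2 * ENNReal.ofReal (discKernel w s)
      ∂arcMeasure := by
  -- Applying the Poisson formula to the holomorphic function `p²` makes the triangle inequality for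
  -- integrals sufficient.
  have h := DiffContOnCl.circleAverage_poissonKernel_smul (c := 0) (R := 1) (w := w)
    (f := fun z => p z ^ 2) (hp.pow 2).diffContOnCl (by simpa using hw)
  rw [Real.circleAverage_def, ← integral_arcMeasure] at h
  rw [← enorm_pow, ← h]
  refine (enorm_integral_le_lintegral_enorm _).trans_eq (lintegral_congr fun s => ?_)
  rw [Pi.smul_apply', enorm_smul, enorm_pow, mul_comm]
  congr 1
  exact Real.enorm_of_nonneg (discKernel_nonneg hw s)

/-- The Poisson kernel composed with a holomorphic self-map is harmonic. -/
theorem IsHolomorphicSelfMap.lintegral_discKernel {φ : 𝔻 → 𝔻} (hφ : IsHolomorphicSelfMap φ)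
    {r : ℝ} (hr : r ∈ Set.Ico (0 : ℝ) 1) (s : ℝ) :
    ∫⁻ t : ℝ, ENNReal.ofReal (discKernel (extendZero (fun z => (φ z : ℂ)) (circleMap 0 r t)) s)
      ∂arcMeasure = ENNReal.ofReal (discKernel (φ 0) s) := by
  set Φ : ℂ → ℂ := extendZero fun z => (φ z : ℂ) with hΦ
  have hΦ1 : ∀ z, ‖Φ z‖ < 1 := fun z => by
    rw [hΦ]
    unfold extendZero
    split_ifs
    · exact (φ _).norm_lt_one
    · simp
  -- The Poisson kernel is the real part of the Herglotz kernel, which is holomorphic in its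
  -- interior point; hence the mean value property after composition with `φ`.
  have hd : DifferentiableOn ℂ (fun z => herglotzRieszKernel 0 (Φ z) (circleMap 0 1 s))
      (Metric.ball 0 1) := by
    simp only [herglotzRieszKernel_def, sub_zero]
    exact DifferentiableOn.div (DifferentiableOn.const_add _ hφ) (DifferentiableOn.const_sub hφ _)
      fun z _ => circleMap_sub_ne_zero (hΦ1 z) s
  have hmean := circleAverage_of_differentiable_on_off_countable (R := r) (c := 0)
    Set.countable_empty
    (hd.continuousOn.mono (Metric.closedBall_subset_ball (by rw [abs_of_nonneg hr.1]; exact hr.2)))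
    fun z hz => hd.differentiableAt (Metric.isOpen_ball.mem_nhds
      (Metric.ball_subset_ball (by rw [abs_of_nonneg hr.1]; exact hr.2.le) hz.1))
  have hcirc : ∀ t, circleMap 0 r t ∈ Metric.ball (0 : ℂ) 1 := fun t => by
    simpa [abs_of_nonneg hr.1] using hr.2
  have hcont : Continuous fun t => herglotzRieszKernel 0 (Φ (circleMap 0 r t)) (circleMap 0 1 s) :=
    hd.continuousOn.comp_continuous (continuous_circleMap 0 r) hcirc
  rw [Real.circleAverage_def, ← integral_arcMeasure] at hmean
  have hint : Integrable (fun t => herglotzRieszKernel 0 (Φ (circleMap 0 r t)) (circleMap 0 1 s))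
      arcMeasure :=
    (hcont.integrableOn_Ioc).smul_measure ENNReal.ofReal_ne_top
  have hre : ∀ w, discKernel w s = (herglotzRieszKernel 0 w (circleMap 0 1 s)).re := fun w => by
    rw [discKernel, poissonKernel_eq_re_herglotzRieszKernel, Function.comp_apply]
  rw [← ofReal_integral_eq_lintegral_ofReal]
  · congr 1
    have h0 : Φ 0 = φ 0 := by simpa using extendZero_coe (fun z => (φ z : ℂ)) 0
    rw [hre, ← h0, ← hmean]
    simp only [hre]
    exact integral_re hint
  · simp only [hre]
    exact hint.re
  · exact Eventually.of_forall fun t => discKernel_nonneg (hΦ1 _) s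

/-- **Littlewood's subordination principle** for entire functions. -/
theorem IsHolomorphicSelfMap.circleMean_comp_le {φ : 𝔻 → 𝔻} (hφ : IsHolomorphicSelfMap φ)
    {p : ℂ → ℂ} (hp : Differentiable ℂ p) {r : ℝ} (hr : r ∈ Set.Ico (0 : ℝ) 1) :
    circleMean (fun z => p (φ z)) r ^ 2 ≤
      ENNReal.ofReal ((1 + ‖(φ 0 : ℂ)‖) / (1 - ‖(φ 0 : ℂ)‖)) * hardyENorm (fun z => p z) ^ 2 := by
  set Φ : ℂ → ℂ := extendZero fun z => (φ z : ℂ) with hΦ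
  have hΦ1 : ∀ t, ‖Φ (circleMap 0 r t)‖ < 1 := fun t => by
    obtain ⟨z, -, hz⟩ := extendZero_circleMap (f := fun z => (φ z : ℂ)) hr t
    rw [hΦ, hz]
    exact (φ z).norm_lt_one
  have hcont := hφ.continuous_circle hr
  have hnorm := hardyENorm_sq_inner_mul_of_continuous (f := fun z => p z) isInner_one
    (isHolomorphic_of_eq hp.differentiableOn fun _ => rfl) hp.continuous fun _ => rfl
  rw [one_mul] at hnorm
  rw [circleMean_sq, hnorm]
  -- Majorize by the Poisson integral, exchange the integrals, average the kernel to its value at `φ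
  -- 0`, and apply Harnack.
  calc ∫⁻ t, ‖extendZero (fun z => p (φ z)) (circleMap 0 r t)‖ₑ ^ 2 ∂arcMeasure
      = ∫⁻ t, ‖p (Φ (circleMap 0 r t))‖ₑ ^ 2 ∂arcMeasure := by
        refine lintegral_congr fun t => ?_
        have hz : ‖circleMap 0 r t‖ < 1 := by simpa [abs_of_nonneg hr.1] using hr.2
        rw [hΦ, extendZero, extendZero, dif_pos hz, dif_pos hz]
    _ ≤ ∫⁻ t, ∫⁻ s, ‖p (circleMap 0 1 s)‖ₑ ^ 2 *
          ENNReal.ofReal (discKernel (Φ (circleMap 0 r t)) s) ∂arcMeasure ∂arcMeasure :=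
        lintegral_mono fun t => enorm_sq_le_lintegral_discKernel hp (hΦ1 t)
    _ = ∫⁻ s, ∫⁻ t, ‖p (circleMap 0 1 s)‖ₑ ^ 2 *
          ENNReal.ofReal (discKernel (Φ (circleMap 0 r t)) s) ∂arcMeasure ∂arcMeasure := by
        have h1 := continuous_discKernel hcont hΦ1
        have h2 : Continuous fun s : ℝ => ‖p (circleMap 0 1 s)‖ₑ ^ 2 :=
          (ENNReal.continuous_pow 2).comp (hp.continuous.comp (continuous_circleMap 0 1)).enorm
        exact lintegral_lintegral_swap
          ((h2.measurable.comp measurable_snd).mul h1.measurable.ennreal_ofReal).aemeasurable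
    _ = ∫⁻ s, ‖p (circleMap 0 1 s)‖ₑ ^ 2 * ENNReal.ofReal (discKernel (φ 0) s) ∂arcMeasure := by
        refine lintegral_congr fun s => ?_
        rw [lintegral_const_mul' _ _ (by simp), hφ.lintegral_discKernel hr]
    _ ≤ ∫⁻ s, ‖p (circleMap 0 1 s)‖ₑ ^ 2 *
          ENNReal.ofReal ((1 + ‖(φ 0 : ℂ)‖) / (1 - ‖(φ 0 : ℂ)‖)) ∂arcMeasure := by
        gcongr with s
        exact discKernel_le (φ 0).norm_lt_one s
    _ = _ := by rw [lintegral_mul_const' _ _ ENNReal.ofReal_ne_top, mul_comm]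

/-- Composition with a holomorphic self-map of the disc preserves `H²`. -/
theorem IsHolomorphicSelfMap.comp_mem_hardySpace {φ : 𝔻 → 𝔻} (hφ : IsHolomorphicSelfMap φ)
    {f : 𝔻 → ℂ} (hf : f ∈ hardySpace) : f ∘ φ ∈ hardySpace := by
  refine ⟨hφ.comp hf.1, ?_⟩
  obtain ⟨a, ha⟩ := hf.1.exists_hasTaylor
  set K : ℝ≥0∞ := ENNReal.ofReal ((1 + ‖(φ 0 : ℂ)‖) / (1 - ‖(φ 0 : ℂ)‖)) with hK
  have hle : ∀ N, hardyENorm (fun z : 𝔻 => taylorSum a N z) ^ 2 ≤ hardyENorm f ^ 2 := fun N => by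
    rw [(hasTaylor_taylorSum a N).hardyENorm_sq, ha.hardyENorm_sq]
    refine ENNReal.tsum_le_tsum fun n => ?_
    split_ifs <;> simp
  -- Fatou's lemma passes from Taylor polynomials to `f`: they converge pointwise, and their norms
  -- are at most that of `f`.
  have hbd : ∀ r ∈ Set.Ico (0 : ℝ) 1, circleMean (f ∘ φ) r ^ 2 ≤ K * hardyENorm f ^ 2 := by
    intro r hr
    have hmeas : ∀ N, Measurable fun t : ℝ =>
        ‖extendZero (fun z => taylorSum a N (φ z)) (circleMap 0 r t)‖ₑ ^ 2 := fun N =>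
      ((ENNReal.continuous_pow 2).comp
        ((hφ.comp (isHolomorphic_taylorSum a N)).continuous_circle hr).enorm).measurable
    rw [circleMean_sq]
    calc ∫⁻ t, ‖extendZero (f ∘ φ) (circleMap 0 r t)‖ₑ ^ 2 ∂arcMeasure
        = ∫⁻ t, liminf (fun N => ‖extendZero (fun z => taylorSum a N (φ z))
            (circleMap 0 r t)‖ₑ ^ 2) atTop ∂arcMeasure := by
          refine lintegral_congr fun t => ?_
          have hz : ‖circleMap 0 r t‖ < 1 := by simpa [abs_of_nonneg hr.1] using hr.2
          simp only [extendZero, dif_pos hz]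
          exact (((ENNReal.continuous_pow 2).comp continuous_enorm).tendsto _ |>.comp
            (ha (φ _)).tendsto_sum_nat).liminf_eq.symm
      _ ≤ liminf (fun N => ∫⁻ t, ‖extendZero (fun z => taylorSum a N (φ z))
            (circleMap 0 r t)‖ₑ ^ 2 ∂arcMeasure) atTop := lintegral_liminf_le hmeas
      _ ≤ liminf (fun _ : ℕ => K * hardyENorm f ^ 2) atTop := by
          refine liminf_le_liminf (Eventually.of_forall fun N => ?_)
          rw [← circleMean_sq]
          refine (hφ.circleMean_comp_le (differentiable_taylorSum a N) hr).trans ?_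
          exact mul_le_mul' le_rfl (hle N)
      _ = _ := liminf_const _
  have hfin : (K * hardyENorm f ^ 2) ^ (2 : ℝ)⁻¹ < ∞ :=
    ENNReal.rpow_lt_top_of_nonneg (by norm_num)
      (ENNReal.mul_ne_top ENNReal.ofReal_ne_top (ENNReal.pow_ne_top hf.2.ne))
  refine lt_of_le_of_lt (iSup₂_le fun r hr => ?_) hfin
  rw [ENNReal.le_rpow_inv_iff two_pos, ENNReal.rpow_ofNat]
  exact hbd r hr

/-! ### Factorization, closedness and the equivalences -/

/-- The quotient of holomorphic functions, if it extends over the zeros of the denominator, gives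
a factorization on the whole disc. -/
theorem mul_eq_of_eq_div {f g ψ : 𝔻 → ℂ} (hf : IsHolomorphic f) (hg : IsHolomorphic g)
    (hψ : IsHolomorphic ψ) (hg0 : g ≠ 0) (h : ∀ z, g z ≠ 0 → ψ z = f z / g z) : g * ψ = f := by
  -- The product `g (g ψ - f)` vanishes also at the zeros of `g`, where nothing is known about `ψ`;
  -- then `g` cancels.
  refine sub_eq_zero.1 ((IsHolomorphic.eq_zero_or_eq_zero_of_mul_eq_zero hg
    ((hg.mul hψ).sub hf) ?_).resolve_left hg0)
  funext z
  by_cases hz : g z = 0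
  · simp [hz]
  · simp [h z hz, mul_div_cancel₀ _ hz]

/-- For `θ` inner, `θ H²` is closed. -/
theorem IsInner.isClosed_mulRange {θ : 𝔻 → ℂ} (hθ : IsInner θ) :
    IsClosed (mulRange θ : Set H2) := by
  let T : H2 →+ H2 := AddMonoidHom.mk' (fun h => ⟨θ * h.1, mul_mem_hardySpace hθ.1 h.2⟩)
    fun f g => Subtype.ext (mul_add θ f.1 g.1)
  -- An isometry from a complete space has closed range.
  have hT : Isometry T := AddMonoidHomClass.isometry_of_norm T fun h =>
    congrArg ENNReal.toReal (hθ.hardyENorm_mul h.2)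
  convert hT.isClosedEmbedding.isClosed_range
  ext f
  constructor
  · rintro ⟨h, hh⟩
    exact ⟨h, Subtype.ext (funext fun z => (hh z).symm)⟩
  · rintro ⟨h, rfl⟩
    exact ⟨h, fun z => rfl⟩

end HardyDisc

end

open HardyDisc in
theorem theorem2p1 (θ : Complex.UnitDisc → ℂ) (φ : Complex.UnitDisc → Complex.UnitDisc)
    (hθ : HardyDisc.IsInner θ) (hφ : HardyDisc.IsHolomorphicSelfMap φ) :
    List.TFAE
      [HardyDisc.MemLatComposition φ (HardyDisc.mulRange θ),
       HardyDisc.QuotientMem (θ ∘ φ) θ HardyDisc.schurClass,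
       HardyDisc.QuotientMem (θ ∘ φ) θ HardyDisc.HInfty,
       HardyDisc.QuotientMem (θ ∘ φ) θ (HardyDisc.hardySpace : Set (Complex.UnitDisc → ℂ))] := by
  have hθφ : IsHolomorphic (θ ∘ φ) := hφ.comp hθ.1.1
  tfae_have 1 → 4 := by
    rintro ⟨-, hinv⟩
    -- Test invariance on `θ = θ · 1`.
    obtain ⟨g, ⟨h, hh⟩, hg⟩ := hinv ⟨θ, HInfty_subset_hardySpace hθ.1⟩
      ⟨⟨1, one_mem_hardySpace⟩, fun z => (mul_one (θ z)).symm⟩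
    refine ⟨h.1, h.2, fun z hz => ?_⟩
    rw [eq_div_iff hz, mul_comm, ← hh, hg]
  tfae_have 4 → 2 := by
    rintro ⟨ψ, hψ, h⟩
    have hfac := mul_eq_of_eq_div hθφ hθ.1.1 hψ.1 hθ.ne_zero h
    have h1 := hθ.norm_le_one_of_mul hψ fun z => by
      rw [hfac]
      exact hθ.norm_le_one (φ z)
    exact ⟨ψ, ⟨⟨hψ.1, 1, h1⟩, h1⟩, h⟩
  tfae_have 2 → 3 := fun ⟨ψ, hψ, h⟩ => ⟨ψ, hψ.1, h⟩
  tfae_have 3 → 4 := fun ⟨ψ, hψ, h⟩ => ⟨ψ, HInfty_subset_hardySpace hψ, h⟩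
  tfae_have 3 → 1 := by
    rintro ⟨ψ, hψ, h⟩
    have hfac := mul_eq_of_eq_div hθφ hθ.1.1 hψ.1 hθ.ne_zero h
    refine ⟨hθ.isClosed_mulRange, ?_⟩
    rintro f ⟨g, hg⟩
    have hgφ := mul_mem_hardySpace hψ (hφ.comp_mem_hardySpace g.2)
    have heq : f.1 ∘ φ = θ * (ψ * (g.1 ∘ φ)) := by
      rw [← mul_assoc, hfac]
      exact funext fun z => hg (φ z)
    exact ⟨⟨_, mul_mem_hardySpace hθ.1 hgφ⟩, ⟨⟨_, hgφ⟩, fun z => rfl⟩, heq.symm⟩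
  tfae_finish
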